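/- Let $\mathbb{D}$ be the open unit disc of $\mathbb{C}$, let $\mathbb{T}=\{\lambda\in\mathbb{C}:|\lambda|=1\}$, and let $\mathrm{Hol}(\mathbb{D})$ be the complex vector space of all holomorphic functions on $\mathbb{D}$, with the topology of uniform convergence on compact subsets of $\mathbb{D}$. For $0<r<1$ and $f\in\mathrm{Hol}(\mathbb{D})$ put $\|f\|_{\infty,r}=\sup_{|z|\le r}|f(z)|$. Let $0<r_1<r_2<1$, and let $T:\mathrm{Hol}(\mathbb{D})\to\mathrm{Hol}(\mathbb{D})$ be a continuous linear operator such that $\|T(f)\|_{\infty,r_i}=\|f\|_{\infty,r_i}$ for all $f\in\mathrm{Hol}(\mathbb{D})$ and $i\in\{1,2\}$. Then there exist constants $\alpha,\beta\in\mathbb{T}$ such that \[ T(f)(z)=\alpha f(\beta z)\qquad\text{for all } f\in\mathrm{Hol}(\mathbb{D}) \text{ and } z\in\mathbb{D}. \] -/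

import Mathlib

/-- `Hol(𝔻)`: the complex vector space of holomorphic functions on the open unit disc. As a
subspace of `C(𝔻, ℂ)` with the compact-open topology, it carries the topology of uniform
convergence on the compact subsets of `𝔻`. -/
def HolDisc : Submodule ℂ C(Complex.UnitDisc, ℂ) where
  carrier := {f | ∃ F : ℂ → ℂ, DifferentiableOn ℂ F (Metric.ball (0 : ℂ) 1) ∧
    ∀ z : Complex.UnitDisc, f z = F (z : ℂ)}
  zero_mem' := ⟨fun _ => 0, differentiableOn_const 0, fun _ => rfl⟩
  add_mem' := by
    rintro f g ⟨F, hF, hfF⟩ ⟨G, hG, hgG⟩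
    exact ⟨fun z => F z + G z, hF.add hG, fun z => by simp [hfF z, hgG z]⟩
  smul_mem' := by
    rintro c f ⟨F, hF, hfF⟩
    exact ⟨fun z => c • F z, hF.const_smul c, fun z => by simp [hfF z]⟩

/-- `‖f‖_{∞,r} = sup_{|z| ≤ r} |f(z)|`, intended for `0 ≤ r < 1`. -/
noncomputable def HolDisc.supSeminorm (r : ℝ) (f : HolDisc) : ℝ :=
  ⨆ z : {z : Complex.UnitDisc // ‖(z : ℂ)‖ ≤ r}, ‖f.1 z.1‖

/-- For `r < 1` the set whose supremum defines `‖f‖_{∞,r}` is bounded above, so that the supremum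
is a genuine one. -/
theorem HolDisc.bddAbove_supSeminorm {r : ℝ} (hr : r < 1) (f : HolDisc) :
    BddAbove (Set.range fun z : {z : Complex.UnitDisc // ‖(z : ℂ)‖ ≤ r} => ‖f.1 z.1‖) := by
  obtain ⟨F, hF, hfF⟩ := f.2
  have hsub : Metric.closedBall (0 : ℂ) r ⊆ Metric.ball (0 : ℂ) 1 :=
    Metric.closedBall_subset_ball hr
  obtain ⟨C, hC⟩ := (isCompact_closedBall (0 : ℂ) r).exists_bound_of_continuousOn
    (hF.continuousOn.mono hsub)
  refine ⟨C, ?_⟩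
  rintro _ ⟨z, rfl⟩
  have h := hC (z.1 : ℂ) (mem_closedBall_zero_iff.2 z.2)
  simpa only [hfF z.1] using h

open Metric Set Filter Topology ComplexConjugate

namespace HolDisc

/-! Since `T 1` has supremum 1 on both closed discs, its modulus peaks inside the larger one, so it
is a unimodular constant `α` there; let `S = conj α • T`. Testing on `1 ± z` shows that `g = S z`
takes both values `±r₁` on the disc of radius `r₁`. As `g` maps the disc of radius `r₂` into its
closure, Schwarz–Pick forces `g 0 = 0` (`Complex.map_zero_of_antipodal`), and equality in the
Schwarz lemma gives `g z = β z`. For `|z| = r₁`, the functional `f ↦ S f z` is unital, contractive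
and sends the coordinate to the peak point `β z`, so it is evaluation there
(`HolDisc.eq_apply_of_contractive`). The identity theorem extends the formula from the circle to the
unit disc. -/

/-- A function on the plane that is holomorphic on the unit disc and agrees there with `f`. -/
noncomputable def extend (f : HolDisc) : ℂ → ℂ := f.2.choose

theorem differentiableOn_extend (f : HolDisc) : DifferentiableOn ℂ (extend f) (ball 0 1) :=
  f.2.choose_spec.1

theorem apply_eq_extend (f : HolDisc) (z : Complex.UnitDisc) : f.1 z = extend f z :=
  f.2.choose_spec.2 z

/-- The constant function `1`. -/
noncomputable def one : HolDisc := ⟨⟨fun _ => 1, continuous_const⟩, fun _ => 1, by fun_prop, fun _ => rfl⟩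

/-- The identity function `z ↦ z`. -/
noncomputable def coord : HolDisc :=
  ⟨⟨fun z => z, Complex.UnitDisc.continuous_coe⟩, fun z => z, by fun_prop, fun _ => rfl⟩

@[simp] theorem one_apply (z : Complex.UnitDisc) : one.1 z = 1 := rfl

@[simp] theorem coord_apply (z : Complex.UnitDisc) : coord.1 z = z := rfl

@[simp] theorem add_apply (f g : HolDisc) (z : Complex.UnitDisc) :
    (f + g).1 z = f.1 z + g.1 z := rfl

@[simp] theorem smul_apply (c : ℂ) (f : HolDisc) (z : Complex.UnitDisc) :
    (c • f).1 z = c * f.1 z := rfl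

/-- Evaluation at a point, as a linear functional. -/
noncomputable def eval (z : Complex.UnitDisc) : HolDisc →ₗ[ℂ] ℂ where
  toFun f := f.1 z
  map_add' _ _ := rfl
  map_smul' _ _ := rfl

@[simp] theorem eval_apply (z : Complex.UnitDisc) (f : HolDisc) : eval z f = f.1 z := rfl

theorem norm_apply_le {r : ℝ} (hr : r < 1) (f : HolDisc) {z : Complex.UnitDisc}
    (hz : ‖(z : ℂ)‖ ≤ r) : ‖f.1 z‖ ≤ supSeminorm r f :=
  le_ciSup (f := fun z : {z : Complex.UnitDisc // ‖(z : ℂ)‖ ≤ r} => ‖f.1 z.1‖)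
    (bddAbove_supSeminorm hr f) ⟨z, hz⟩

theorem supSeminorm_le {r C : ℝ} (hr : 0 ≤ r) {f : HolDisc}
    (h : ∀ z : Complex.UnitDisc, ‖(z : ℂ)‖ ≤ r → ‖f.1 z‖ ≤ C) : supSeminorm r f ≤ C := by
  have : Nonempty {z : Complex.UnitDisc // ‖(z : ℂ)‖ ≤ r} := ⟨⟨0, by simpa using hr⟩⟩
  exact ciSup_le fun z => h z.1 z.2

theorem exists_norm_apply_eq {r : ℝ} (hr₀ : 0 ≤ r) (hr : r < 1) (f : HolDisc) :
    ∃ z : Complex.UnitDisc, ‖(z : ℂ)‖ ≤ r ∧ ‖f.1 z‖ = supSeminorm r f := by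
  obtain ⟨w, hw, hmax⟩ := (isCompact_closedBall (0 : ℂ) r).exists_isMaxOn
    ⟨0, mem_closedBall_self hr₀⟩
    (((differentiableOn_extend f).continuousOn.mono (closedBall_subset_ball hr)).norm)
  rw [mem_closedBall_zero_iff] at hw
  refine ⟨.mk w (hw.trans_lt hr), hw, le_antisymm (norm_apply_le hr f hw) ?_⟩
  refine supSeminorm_le hr₀ fun z hz => ?_
  simpa only [apply_eq_extend] using! hmax (mem_closedBall_zero_iff.2 hz)

theorem supSeminorm_eq_of_exists {r C : ℝ} (hr : r < 1) {f : HolDisc}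
    (h : ∀ z : Complex.UnitDisc, ‖(z : ℂ)‖ ≤ r → ‖f.1 z‖ ≤ C)
    (hC : ∃ z : Complex.UnitDisc, ‖(z : ℂ)‖ ≤ r ∧ ‖f.1 z‖ = C) : supSeminorm r f = C := by
  obtain ⟨z, hz, rfl⟩ := hC
  exact le_antisymm (supSeminorm_le ((norm_nonneg _).trans hz) h) (norm_apply_le hr f hz)

theorem supSeminorm_one {r : ℝ} (hr₀ : 0 ≤ r) (hr : r < 1) : supSeminorm r one = 1 :=
  supSeminorm_eq_of_exists hr (by simp) ⟨0, by simpa using hr₀⟩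

theorem supSeminorm_coord {r : ℝ} (hr₀ : 0 ≤ r) (hr : r < 1) : supSeminorm r coord = r :=
  supSeminorm_eq_of_exists hr (fun _ h => h)
    ⟨.mk r (by simpa [abs_of_nonneg hr₀] using hr), by simp [abs_of_nonneg hr₀]⟩

/-- For `s = ±1`, the sup-seminorm of `1 + s z`. -/
theorem supSeminorm_one_add_smul_coord {r s : ℝ} (hr₀ : 0 ≤ r) (hr : r < 1) (hs : s * s = 1) :
    supSeminorm r (one + (s : ℂ) • coord) = 1 + r := by
  have hs' : |s| = 1 := by
    rcases mul_self_eq_one_iff.1 hs with rfl | rfl <;> simp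
  have hn : ‖((s * r : ℝ) : ℂ)‖ = r := by
    rw [Complex.norm_real, Real.norm_eq_abs, abs_mul, hs', one_mul, abs_of_nonneg hr₀]
  refine supSeminorm_eq_of_exists hr (fun z hz => ?_)
    ⟨.mk (s * r : ℝ) (by rwa [hn]), hn.le, ?_⟩
  · refine (norm_add_le _ _).trans ?_
    simpa [hs'] using hz
  · have : (1 : ℂ) + s * ((s * r : ℝ) : ℂ) = ((1 + r : ℝ) : ℂ) := by
      rw [← Complex.ofReal_mul, ← mul_assoc, hs]; simp
    simp only [add_apply, one_apply, smul_apply, coord_apply, Complex.UnitDisc.coe_mk]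
    rw [this, Complex.norm_real, Real.norm_of_nonneg (by positivity)]

/-! ### Unital contractive functionals and peak points -/

/-- A unital contractive functional preserves upper bounds of real parts. -/
theorem re_le_of_contractive {r c : ℝ} (hr : r < 1) {L : HolDisc →ₗ[ℂ] ℂ}
    (hL : ∀ f, ‖L f‖ ≤ supSeminorm r f) (hL₁ : L one = 1) (hr₀ : 0 ≤ r) {f : HolDisc}
    (hf : ∀ z : Complex.UnitDisc, ‖(z : ℂ)‖ ≤ r → (f.1 z).re ≤ c) : (L f).re ≤ c := by
  set B := supSeminorm r f
  -- Translating by a large `N` makes the imaginary part a bounded error in the squared norm, while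
  -- a gap between `(L f).re` and `c` would grow linearly in `N`.
  have key : ∀ N : ℝ, B ≤ N → ((L f).re + N) ^ 2 ≤ (c + N) ^ 2 + B ^ 2 := by
    intro N hN
    have h₁ : supSeminorm r (f + (N : ℂ) • one) ≤ √((c + N) ^ 2 + B ^ 2) := by
      refine supSeminorm_le hr₀ fun z hz => Real.le_sqrt_of_sq_le ?_
      have hB := norm_apply_le hr f hz
      have hre := (Complex.abs_re_le_norm (f.1 z)).trans hB
      have him := (Complex.abs_im_le_norm (f.1 z)).trans hB
      rw [← Complex.normSq_eq_norm_sq, Complex.normSq_apply]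
      have h₂ : 0 ≤ (f.1 z).re + N := by linarith [neg_abs_le (f.1 z).re]
      have h₃ : (f.1 z).im ^ 2 ≤ B ^ 2 := sq_le_sq' (abs_le.1 him).1 (abs_le.1 him).2
      have h₄ : ((f.1 z).re + N) ^ 2 ≤ (c + N) ^ 2 := by
        have := hf z hz; gcongr
      simp only [add_apply, smul_apply, one_apply, mul_one, Complex.add_re, Complex.ofReal_re,
        Complex.add_im, Complex.ofReal_im, add_zero]
      nlinarith
    have h₂ := (Complex.abs_re_le_norm _).trans ((hL (f + (N : ℂ) • one)).trans h₁)
    have h₃ : (L (f + (N : ℂ) • one)).re = (L f).re + N := by simp [hL₁]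
    rw [h₃, Real.le_sqrt (abs_nonneg _) (by positivity), sq_abs] at h₂
    exact h₂
  by_contra! hlt
  have h₁ := key (|B| + (c ^ 2 + B ^ 2) / ((L f).re - c)) (by
    have : 0 ≤ (c ^ 2 + B ^ 2) / ((L f).re - c) := div_nonneg (by positivity) (by linarith)
    linarith [le_abs_self B])
  have h₂ : (c ^ 2 + B ^ 2) / ((L f).re - c) * ((L f).re - c) = c ^ 2 + B ^ 2 :=
    div_mul_cancel₀ _ (by linarith)
  set Q := (c ^ 2 + B ^ 2) / ((L f).re - c)
  have h₃ : 0 < ((L f).re - c) ^ 2 := by have := sub_pos.2 hlt; positivity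
  nlinarith [mul_nonneg (sub_pos.2 hlt).le (abs_nonneg B), sq_nonneg ((L f).re + c), sq_nonneg B]

/-- A unital contractive functional that maps the coordinate to a point `w` of the bounding circle
is the evaluation at `w`. -/
theorem eq_apply_of_contractive {r : ℝ} (hr : r < 1) {L : HolDisc →ₗ[ℂ] ℂ}
    (hL : ∀ f, ‖L f‖ ≤ supSeminorm r f) (hL₁ : L one = 1) (w : Complex.UnitDisc)
    (hw : ‖(w : ℂ)‖ = r) (hLw : L coord = w) (f : HolDisc) : L f = f.1 w := by
  have hr₀ : 0 ≤ r := hw ▸ norm_nonneg _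
  have hwb : (w : ℂ) ∈ ball (0 : ℂ) 1 := mem_ball_zero_iff.2 w.norm_lt_one
  have hd : ContinuousOn (dslope (extend f) w) (closedBall 0 r) :=
    (((Complex.differentiableOn_dslope (isOpen_ball.mem_nhds hwb)).2
      (differentiableOn_extend f)).continuousOn).mono (closedBall_subset_ball hr)
  obtain ⟨C, hC⟩ := (isCompact_closedBall (0 : ℂ) r).exists_bound_of_continuousOn hd
  have hlip : ∀ z : Complex.UnitDisc, ‖(z : ℂ)‖ ≤ r → ‖f.1 z - f.1 w‖ ≤ C * ‖(z - w : ℂ)‖ := by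
    intro z hz
    rw [apply_eq_extend, apply_eq_extend, ← sub_smul_dslope, norm_smul, mul_comm]
    gcongr
    exact hC z (mem_closedBall_zero_iff.2 hz)
  set d := L f - f.1 w with hd_def
  have hle : ∀ ε : ℝ, 0 < ε → ‖d‖ ^ 2 ≤ 0 + ε := by
    intro ε hε
    -- `K` makes `M t ≤ ε + K t² / 2` for every `t`. The real part of `conj w * z` peaks at `w`,
    -- dropping by at least `|z - w|² / 2`; the `K` term of the test function thus absorbs the
    -- Lipschitz error.
    set M := ‖d‖ * C
    set K := M ^ 2 / (2 * ε)
    have hKε : K * (2 * ε) = M ^ 2 := div_mul_cancel₀ _ (by positivity)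
    have hK₀ : 0 ≤ K := by positivity
    have hww : conj (w : ℂ) * w = ((r ^ 2 : ℝ) : ℂ) := by
      rw [← Complex.normSq_eq_conj_mul_self, Complex.normSq_eq_norm_sq, hw]
    have h := re_le_of_contractive hr hL hL₁ hr₀ (c := ε + K * r ^ 2)
      (f := conj d • (f + (-f.1 w) • one) + (K * conj (w : ℂ)) • coord) (by
        intro z hz
        have h₁ : (conj d * (f.1 z - f.1 w)).re ≤ M * ‖(z - w : ℂ)‖ := by
          refine (Complex.re_le_norm _).trans ?_
          rw [norm_mul, RCLike.norm_conj, mul_assoc]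
          exact mul_le_mul_of_nonneg_left (hlip z hz) (norm_nonneg _)
        have h₂ : ‖(z - w : ℂ)‖ ^ 2 ≤ 2 * (r ^ 2 - (conj (w : ℂ) * z).re) := by
          have hz2 : ‖(z : ℂ)‖ ^ 2 ≤ r ^ 2 := by gcongr
          have hw2 : ‖(w : ℂ)‖ ^ 2 = r ^ 2 := by rw [hw]
          rw [← Complex.normSq_eq_norm_sq, Complex.normSq_apply] at *
          simp only [Complex.sub_re, Complex.sub_im, Complex.mul_re, Complex.conj_re,
            Complex.conj_im]
          nlinarith
        have h₃ : M * ‖(z - w : ℂ)‖ ≤ ε + K / 2 * ‖(z - w : ℂ)‖ ^ 2 := by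
          have h₄ : 0 ≤ (M * ‖(z - w : ℂ)‖ - 2 * ε) ^ 2 := sq_nonneg _
          rw [← sub_nonneg]
          have : 0 ≤ (4 * ε) * (ε + K / 2 * ‖(z - w : ℂ)‖ ^ 2 - M * ‖(z - w : ℂ)‖) := by
            have : K * (2 * ε) * ‖(z - w : ℂ)‖ ^ 2 = M ^ 2 * ‖(z - w : ℂ)‖ ^ 2 := by rw [hKε]
            nlinarith
          exact nonneg_of_mul_nonneg_right this (by positivity)
        have h₅ : (K * conj (w : ℂ) * z).re = K * (conj (w : ℂ) * z).re := by
          rw [mul_assoc, Complex.re_ofReal_mul]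
        simp only [add_apply, smul_apply, one_apply, mul_one, coord_apply,
          Complex.add_re, ← sub_eq_add_neg]
        rw [h₅]
        nlinarith [mul_le_mul_of_nonneg_left h₂ hK₀])
    have hval : L (conj d • (f + (-f.1 w) • one) + (K * conj (w : ℂ)) • coord) =
        ((‖d‖ ^ 2 + K * r ^ 2 : ℝ) : ℂ) := by
      simp only [map_add, map_smul, hL₁, hLw, smul_eq_mul, mul_one]
      rw [mul_assoc, hww, ← sub_eq_add_neg, ← hd_def, ← Complex.normSq_eq_conj_mul_self, Complex.normSq_eq_norm_sq]
      push_cast; ring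
    rw [hval, Complex.ofReal_re] at h
    linarith
  have h0 : ‖d‖ ^ 2 ≤ 0 := le_of_forall_pos_le_add hle
  have : d = 0 := by
    rw [← norm_eq_zero]; exact pow_eq_zero_iff two_ne_zero |>.1 (le_antisymm h0 (by positivity))
  exact sub_eq_zero.1 this

end HolDisc

/-! ### Schwarz–Pick and equality cases -/

/-- The Schwarz–Pick inequality for the centre and a second point. -/
theorem Complex.norm_sub_le_of_mapsTo_ball {R : ℝ} {g : ℂ → ℂ}
    (hd : DifferentiableOn ℂ g (ball 0 R)) (hg : MapsTo g (ball 0 R) (closedBall 0 R))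
    (h0 : ‖g 0‖ < R) {z : ℂ} (hz : ‖z‖ < R) :
    R ^ 2 * ‖g z - g 0‖ ≤ ‖z‖ * ‖R ^ 2 - conj (g 0) * g z‖ := by
  have hR : 0 < R := (norm_nonneg _).trans_lt h0
  set p := g 0 with hp
  have hne : ∀ w ∈ ball (0 : ℂ) R, (R ^ 2 - conj p * g w : ℂ) ≠ 0 := by
    intro w hw h
    have h₁ : ‖(R ^ 2 : ℂ)‖ = ‖conj p * g w‖ := by rw [sub_eq_zero.1 h]
    have h₂ := mem_closedBall_zero_iff.1 (hg hw)
    rw [norm_mul, RCLike.norm_conj, norm_pow, Complex.norm_real, Real.norm_of_nonneg hR.le] at h₁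
    nlinarith [norm_nonneg (g w), norm_nonneg p]
  -- The automorphism of the disc of radius `R` taking `p` to 0 reduces the claim to the Schwarz
  -- lemma. It preserves the disc because `|R² - conj p * u|² - R² |u - p|² = (R² - |p|²)(R² -
  -- |u|²)`.
  have hmaps : MapsTo (fun w => R ^ 2 * (g w - p) / (R ^ 2 - conj p * g w)) (ball 0 R)
      (closedBall 0 R) := by
    intro w hw
    have h₂ := mem_closedBall_zero_iff.1 (hg hw)
    have h₃ : R * ‖g w - p‖ ≤ ‖R ^ 2 - conj p * g w‖ := by
      refine le_of_sq_le_sq ?_ (norm_nonneg _)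
      have hp2 : 0 ≤ R ^ 2 - ‖p‖ ^ 2 := sub_nonneg.2 (by gcongr)
      have hw2 : 0 ≤ R ^ 2 - ‖g w‖ ^ 2 := sub_nonneg.2 (by gcongr)
      have h₃ := mul_nonneg hp2 hw2
      simp only [mul_pow, ← Complex.normSq_eq_norm_sq, Complex.normSq_apply] at h₃ ⊢
      simp [← Complex.ofReal_pow]
      nlinarith
    rw [mem_closedBall_zero_iff, norm_div, norm_mul, norm_pow, Complex.norm_real,
      Real.norm_of_nonneg hR.le, div_le_iff₀ (norm_pos_iff.2 (hne w hw))]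
    nlinarith
  have hdiff : DifferentiableOn ℂ (fun w => R ^ 2 * (g w - p) / (R ^ 2 - conj p * g w))
      (ball 0 R) := by
    refine DifferentiableOn.div ?_ ?_ hne <;> fun_prop
  have h := Complex.norm_le_norm_of_mapsTo_ball hdiff hmaps (by simp [hp]) hz
  rwa [norm_div, norm_mul, norm_pow, Complex.norm_real, Real.norm_of_nonneg hR.le,
    div_le_iff₀ (norm_pos_iff.2 (hne z (mem_ball_zero_iff.2 hz)))] at h

/-- A self-map of a disc that attains two antipodal values `±r` on the concentric closed disc of
radius `r` fixes the centre. -/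
theorem Complex.map_zero_of_antipodal {r R : ℝ} (hr : 0 < r) (hrR : r < R) {g : ℂ → ℂ}
    (hd : DifferentiableOn ℂ g (ball 0 R)) (hg : MapsTo g (ball 0 R) (closedBall 0 R))
    (h0 : ‖g 0‖ < R) {z w : ℂ} (hz : ‖z‖ ≤ r) (hw : ‖w‖ ≤ r) (hgz : g z = r) (hgw : g w = -r) :
    g 0 = 0 := by
  have h₁ := norm_sub_le_of_mapsTo_ball hd hg h0 (hz.trans_lt hrR)
  have h₂ := norm_sub_le_of_mapsTo_ball hd hg h0 (hw.trans_lt hrR)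
  rw [hgz] at h₁
  rw [hgw] at h₂
  replace h₁ := h₁.trans (mul_le_mul_of_nonneg_right hz (norm_nonneg _))
  replace h₂ := h₂.trans (mul_le_mul_of_nonneg_right hw (norm_nonneg _))
  set p := g 0
  have h₃ := pow_le_pow_left₀ (by positivity) h₁ 2
  have h₄ := pow_le_pow_left₀ (by positivity) h₂ 2
  simp only [mul_pow, ← Complex.normSq_eq_norm_sq, Complex.normSq_apply] at h₃ h₄
  simp [← Complex.ofReal_pow] at h₃ h₄
  -- Adding the squared inequalities for `r` and `-r` cancels the cross terms.
  have h₅ : R ^ 4 * (p.re ^ 2 + p.im ^ 2) ≤ r ^ 4 * (p.re ^ 2 + p.im ^ 2) := by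
    nlinarith
  have h₆ : r ^ 4 < R ^ 4 := by gcongr
  have h₇ : p.re ^ 2 + p.im ^ 2 ≤ 0 := by nlinarith
  apply Complex.ext <;> simp <;> nlinarith [sq_nonneg p.re, sq_nonneg p.im]

/-- If `‖u‖ ≤ r`, `s = ±1` and `‖1 + s u‖ = 1 + r`, then `u = s r`. -/
theorem Complex.eq_of_norm_one_add {r s : ℝ} {u : ℂ} (hs : s * s = 1)
    (hu : ‖u‖ ≤ r) (h : ‖1 + s * u‖ = 1 + r) : u = s * r := by
  have h₁ : ‖u‖ ^ 2 ≤ r ^ 2 := by gcongr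
  have h₂ : ‖1 + s * u‖ ^ 2 = (1 + r) ^ 2 := by rw [h]
  rw [← Complex.normSq_eq_norm_sq, Complex.normSq_apply] at h₁ h₂
  simp at h₂
  have hr : 0 ≤ r := (norm_nonneg _).trans hu
  have h₃ : (s * u.re) ^ 2 = u.re ^ 2 := by rw [mul_pow, sq s, hs, one_mul]
  have h₄ : (s * u.im) ^ 2 = u.im ^ 2 := by rw [mul_pow, sq s, hs, one_mul]
  have h₅ : r ≤ s * u.re := by nlinarith
  have h₆ : u.im = 0 := by nlinarith
  have h₇ : s * u.re = r := le_antisymm (by nlinarith) h₅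
  apply Complex.ext
  · simp [← h₇, ← mul_assoc, hs]
  · simp [h₆]

/-! ### Rigidity of `T` -/

theorem mainTheorem1 (r₁ r₂ : ℝ) (hr₁ : 0 < r₁) (hr₁₂ : r₁ < r₂) (hr₂ : r₂ < 1)
    (T : HolDisc →L[ℂ] HolDisc)
    (hT₁ : ∀ f : HolDisc, HolDisc.supSeminorm r₁ (T f) = HolDisc.supSeminorm r₁ f)
    (hT₂ : ∀ f : HolDisc, HolDisc.supSeminorm r₂ (T f) = HolDisc.supSeminorm r₂ f) :
    ∃ α β : Circle, ∀ (f : HolDisc) (z : Complex.UnitDisc),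
      (T f).1 z = (α : ℂ) * f.1 (β • z) := by
  have hr₁' : r₁ < 1 := hr₁₂.trans hr₂
  have hr₂₀ : 0 < r₂ := hr₁.trans hr₁₂
  have hsub : ball (0 : ℂ) r₂ ⊆ ball 0 1 := ball_subset_ball hr₂.le
  -- `T 1` is a unimodular constant on the disc of radius `r₂`.
  obtain ⟨α, hα⟩ : ∃ α : Circle, ∀ z : Complex.UnitDisc, ‖(z : ℂ)‖ < r₂ →
      (T HolDisc.one).1 z = α := by
    obtain ⟨z₀, hz₀, hz₀'⟩ := HolDisc.exists_norm_apply_eq hr₁.le hr₁' (T HolDisc.one)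
    rw [hT₁, HolDisc.supSeminorm_one hr₁.le hr₁'] at hz₀'
    refine ⟨⟨(T HolDisc.one).1 z₀, mem_sphere_zero_iff_norm.2 hz₀'⟩, fun z hz => ?_⟩
    rw [HolDisc.apply_eq_extend]
    have := Complex.eqOn_of_isPreconnected_of_isMaxOn_norm (c := (z₀ : ℂ))
      (convex_ball (0 : ℂ) r₂).isPreconnected isOpen_ball
      ((HolDisc.differentiableOn_extend (T HolDisc.one)).mono hsub)
      (mem_ball_zero_iff.2 (hz₀.trans_lt hr₁₂)) (by
        intro w hw
        have hw' := mem_ball_zero_iff.1 hw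
        have := HolDisc.norm_apply_le hr₂ (T HolDisc.one) (z := .mk w (hw'.trans hr₂)) hw'.le
        rw [hT₂, HolDisc.supSeminorm_one hr₂₀.le hr₂, HolDisc.apply_eq_extend] at this
        rw [HolDisc.apply_eq_extend] at hz₀'
        simpa [hz₀'] using this) (mem_ball_zero_iff.2 hz)
    simpa [HolDisc.apply_eq_extend] using this
  have hαα : conj (α : ℂ) * α = 1 := by
    rw [← Complex.normSq_eq_conj_mul_self]; simp
  have hαn : ‖conj (α : ℂ)‖ = 1 := by rw [RCLike.norm_conj, Circle.norm_coe]
  set S : HolDisc →ₗ[ℂ] HolDisc := conj (α : ℂ) • T.toLinearMap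
  have hSapp : ∀ f z, (S f).1 z = conj (α : ℂ) * (T f).1 z := fun _ _ => rfl
  have hS₁ : ∀ z : Complex.UnitDisc, ‖(z : ℂ)‖ < r₂ → (S HolDisc.one).1 z = 1 := fun z hz => by
    rw [hSapp, hα z hz, hαα]
  have hSnorm : ∀ f z, ‖(S f).1 z‖ = ‖(T f).1 z‖ := fun f z => by
    rw [hSapp, norm_mul, hαn, one_mul]
  have hS_le₁ : ∀ (f) (z : Complex.UnitDisc), ‖(z : ℂ)‖ ≤ r₁ →
      ‖(S f).1 z‖ ≤ HolDisc.supSeminorm r₁ f := fun f z hz => by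
    rw [hSnorm, ← hT₁]; exact HolDisc.norm_apply_le hr₁' _ hz
  have hS_le₂ : ∀ (f) (z : Complex.UnitDisc), ‖(z : ℂ)‖ ≤ r₂ →
      ‖(S f).1 z‖ ≤ HolDisc.supSeminorm r₂ f := fun f z hz => by
    rw [hSnorm, ← hT₂]; exact HolDisc.norm_apply_le hr₂ _ hz
  -- The image of the coordinate attains the values `± r₁` on the closed disc of radius `r₁`.
  set g := HolDisc.extend (S HolDisc.coord) with hg
  have hanti : ∀ s : ℝ, s * s = 1 → ∃ z : ℂ, ‖z‖ ≤ r₁ ∧ g z = s * r₁ := by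
    intro s hs
    obtain ⟨z, hz, hz'⟩ := HolDisc.exists_norm_apply_eq hr₁.le hr₁' (T (HolDisc.one + (s : ℂ) • HolDisc.coord))
    refine ⟨z, hz, ?_⟩
    rw [hT₁, HolDisc.supSeminorm_one_add_smul_coord hr₁.le hr₁' hs, ← hSnorm, map_add, map_smul,
      HolDisc.add_apply, hS₁ z (hz.trans_lt hr₁₂), HolDisc.smul_apply] at hz'
    rw [hg, ← HolDisc.apply_eq_extend]
    refine Complex.eq_of_norm_one_add hs ?_ hz'
    simpa [HolDisc.supSeminorm_coord hr₁.le hr₁'] using hS_le₁ HolDisc.coord z hz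
  have hgd : DifferentiableOn ℂ g (ball 0 r₂) :=
    (HolDisc.differentiableOn_extend (S HolDisc.coord)).mono hsub
  have hgm : MapsTo g (ball 0 r₂) (closedBall 0 r₂) := by
    intro w hw
    have hw' := mem_ball_zero_iff.1 hw
    have := hS_le₂ HolDisc.coord (.mk w (hw'.trans hr₂)) hw'.le
    rw [HolDisc.supSeminorm_coord hr₂₀.le hr₂, HolDisc.apply_eq_extend] at this
    exact mem_closedBall_zero_iff.2 this
  obtain ⟨z₁, hz₁, hgz₁⟩ := hanti 1 (by norm_num)
  obtain ⟨z₂, hz₂, hgz₂⟩ := hanti (-1) (by norm_num)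
  simp only [Complex.ofReal_one, one_mul, Complex.ofReal_neg, neg_mul] at hgz₁ hgz₂
  have hg0 : g 0 = 0 := by
    refine Complex.map_zero_of_antipodal hr₁ hr₁₂ hgd hgm ?_ hz₁ hz₂ hgz₁ hgz₂
    have := hS_le₁ HolDisc.coord 0 (by simpa using hr₁.le)
    rw [HolDisc.supSeminorm_coord hr₁.le hr₁', HolDisc.apply_eq_extend,
      Complex.UnitDisc.coe_zero] at this
    exact this.trans_lt hr₁₂
  have hz₁b : z₁ ∈ ball (0 : ℂ) r₂ := mem_ball_zero_iff.2 (hz₁.trans_lt hr₁₂)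
  obtain ⟨β, hβ⟩ : ∃ β : Circle, ∀ z ∈ ball (0 : ℂ) r₂, g z = β * z := by
    have hz₁0 : z₁ ≠ 0 := by
      rintro rfl
      rw [hg0] at hgz₁
      exact hr₁.ne (by exact_mod_cast hgz₁)
    have hgm' : MapsTo g (ball 0 r₂) (closedBall (g 0) r₂) := by rwa [hg0]
    -- `|g z₁| = r₁ ≥ |z₁|` is the equality case of the Schwarz lemma.
    obtain ⟨C, hC, hCe⟩ := Complex.affine_of_mapsTo_ball_of_exists_norm_dslope_eq_div' hgd hgm'
      ⟨z₁, hz₁b, by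
        refine le_antisymm (Complex.norm_dslope_le_div_of_mapsTo_ball hgd hgm' hz₁b) ?_
        rw [dslope_of_ne _ hz₁0, slope_def_field, hg0, hgz₁, sub_zero, sub_zero, norm_div,
          Complex.norm_real, Real.norm_of_nonneg hr₁.le, div_self hr₂₀.ne',
          one_le_div (norm_pos_iff.2 hz₁0)]
        exact hz₁⟩
    rw [div_self hr₂₀.ne'] at hC
    refine ⟨⟨C, mem_sphere_zero_iff_norm.2 hC⟩, fun z hz => ?_⟩
    rw [hCe hz, hg0]
    simp [mul_comm]
  refine ⟨α, β, fun f => ?_⟩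
  have hcirc : ∀ z : Complex.UnitDisc, ‖(z : ℂ)‖ = r₁ → (T f).1 z = α * f.1 (β • z) := by
    intro z hz
    have h := HolDisc.eq_apply_of_contractive hr₁' (L := (HolDisc.eval z).comp S)
      (fun f => hS_le₁ f z hz.le) (hS₁ z (hz.trans_lt hr₁₂)) (β • z)
      (by rwa [Complex.UnitDisc.coe_circle_smul, norm_mul, Circle.norm_coe, one_mul]) (by
        rw [LinearMap.comp_apply, HolDisc.eval_apply, HolDisc.apply_eq_extend,
          Complex.UnitDisc.coe_circle_smul]
        exact hβ z (mem_ball_zero_iff.2 (hz.trans_lt hr₁₂))) f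
    rw [← h, LinearMap.comp_apply, HolDisc.eval_apply, hSapp, ← mul_assoc, mul_comm (α : ℂ), hαα,
      one_mul]
  have hmaps : MapsTo (fun z : ℂ => β * z) (ball 0 1) (ball 0 1) := fun z hz => by
    rwa [mem_ball_zero_iff, norm_mul, Circle.norm_coe, one_mul, ← mem_ball_zero_iff]
  have heq : EqOn (HolDisc.extend (T f)) (fun z => (α : ℂ) * HolDisc.extend f (β * z)) (ball 0 1) := by
    have hr₁n : ‖(r₁ : ℂ)‖ = r₁ := by simp [hr₁.le]
    refine AnalyticOnNhd.eqOn_of_preconnected_of_frequently_eq (z₀ := (r₁ : ℂ))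
      ((HolDisc.differentiableOn_extend (T f)).analyticOnNhd isOpen_ball)
      (DifferentiableOn.analyticOnNhd (((HolDisc.differentiableOn_extend f).comp
        (by fun_prop) hmaps).const_mul _) isOpen_ball)
      (convex_ball (0 : ℂ) 1).isPreconnected (mem_ball_zero_iff.2 (by rwa [hr₁n])) ?_
    -- Points of the circle accumulate at `r₁`; a small positive angle has nonzero sine, so they
    -- avoid `r₁` itself.
    have htend : Tendsto (fun t : ℝ => (r₁ : ℂ) * Complex.exp (t * Complex.I)) (𝓝[>] 0)
        (𝓝[≠] (r₁ : ℂ)) := by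
      refine tendsto_nhdsWithin_iff.2 ⟨?_, ?_⟩
      · refine tendsto_nhdsWithin_of_tendsto_nhds ?_
        have : Continuous fun t : ℝ => (r₁ : ℂ) * Complex.exp (t * Complex.I) := by fun_prop
        simpa using this.tendsto 0
      · filter_upwards [Ioo_mem_nhdsGT Real.pi_pos] with t ht h
        have him := congrArg Complex.im h
        rw [Complex.im_ofReal_mul, Complex.exp_ofReal_mul_I_im, Complex.ofReal_im] at him
        exact (mul_pos hr₁ (Real.sin_pos_of_mem_Ioo ht)).ne' him
    refine htend.frequently (Eventually.frequently (Eventually.of_forall fun t => ?_))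
    have hn : ‖(r₁ : ℂ) * Complex.exp (t * Complex.I)‖ = r₁ := by
      rw [norm_mul, Complex.norm_exp_ofReal_mul_I, mul_one, hr₁n]
    have := hcirc (.mk _ (hn.trans_lt hr₁')) hn
    simpa [HolDisc.apply_eq_extend] using this
  intro z
  simpa [HolDisc.apply_eq_extend] using heq (mem_ball_zero_iff.2 z.norm_lt_one)
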